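/- Let $(W,H,\mu)$ be an abstract Wiener space: $W$ is a separable real Banach space, $H$ a real Hilbert space injected continuously and densely in $W$, and $\mu$ the Borel probability measure on $W$ with $\int_W e^{i\langle e,w\rangle}\mu(dw)=e^{-|j(e)|_H^2/2}$ for every $e\in W^*$, where $j:W^*\to H$ is the adjoint of the injection $H\hookrightarrow W$. Let $\nabla$ be the $H$-valued gradient, given on cylindrical functions $\varphi=f(\langle v_1,\cdot\rangle,\dots,\langle v_m,\cdot\rangle)$ with $f\in C_0^\infty(\mathbb R^m)$, $v_k\in W^*$, by $\nabla\varphi=\sum_k\partial_kf(\langle v_1,\cdot\rangle,\dots,\langle v_m,\cdot\rangle)\,j(v_k)$. The divergence $\delta$ is its adjoint with respect to $\mu$: a field $u\in L^2(\mu;H)$ is in the domain of $\delta$, with divergence $\delta u\in L^2(\mu)$, if $E[(\nabla\varphi,u)_H]=E[\varphi\,\delta u]$ for all such $\varphi$; for $h\in H$, $\delta h$ denotes the divergence of the constant field $h$. Let $(Q_n)_{n\ge1}$ be random isometries of $H$, that is, random bounded linear operators $Q_n(w)$ on $H$ such that for every $h\in H$ the map $w\mapsto Q_n(w)h$ is measurable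 and $|Q_n(w)h|_H=|h|_H$ for $\mu$-almost every $w$. Assume that for all $n\ge 1$ and all $h\in H$: $Q_nh$ is in the domain of $\delta$; the random variable $\delta(Q_nh)$ has the law $N(0,|h|_H^2)$; and $$E\Bigl[F(w+Q_n(w)h)\exp\bigl\{-\delta(Q_nh)(w)-\tfrac12|h|_H^2\bigr\}\Bigr]=E[F]$$ for every bounded continuous $F:W\to\mathbb R$. Then for every $n$ there is a $\mu$-preserving measurable map $T_n:W\to W$, unique up to $\mu$-null sets, such that $\delta h\circ T_n=\delta(Q_nh)$ $\mu$-almost surely for every $h\in H$. If moreover $(Q_nh,k)_H\to0$ in $\mu$-probability as $n\to\infty$ for all $h,k\in H$, then $(T_n)_{n\ge1}$ is strongly mixing, that is, $$\lim_{n\to\infty}E[F\cdot G\circ T_n]=E[F]\,E[G]\qquad\text{for all }F,G\in L^2(\mu).$$ -/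

import Mathlib

open MeasureTheory ProbabilityTheory Filter Topology
open scoped ContDiff BoundedContinuousFunction NNReal

namespace WienerSpace

noncomputable section

variable {W H : Type*} [NormedAddCommGroup W] [NormedSpace ℝ W]
  [NormedAddCommGroup H] [InnerProductSpace ℝ H] [CompleteSpace H]

/-- The canonical map `j : W* → H` attached to a continuous injection `i : H → W`: the element
`j e` of `H` represents the functional `e ∘ i`, that is `(j e, h)_H = ⟨e, i h⟩`. -/
def dualEmb (i : H →L[ℝ] W) (e : StrongDual ℝ W) : H :=
  (InnerProductSpace.toDual ℝ H).symm (e.comp i)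

/-- `(W, H, μ)` is an abstract Wiener space: `H` is continuously and densely injected in `W` by
`i`, and `∫ exp (√-1 ⟨e, w⟩) μ(dw) = exp (-|j e|² / 2)` for every `e ∈ W*`. -/
structure IsAbstractWienerSpace [MeasurableSpace W] (i : H →L[ℝ] W) (μ : Measure W) : Prop where
  isProbabilityMeasure : IsProbabilityMeasure μ
  injective : Function.Injective i
  denseRange : DenseRange i
  charFun_eq : ∀ e : StrongDual ℝ W,
    ∫ w, Complex.exp (Complex.I * (e w : ℂ)) ∂μ
      = Complex.exp (((-(‖dualEmb i e‖ ^ 2) / 2 : ℝ)) : ℂ)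

/-- The cylindrical function `w ↦ f (⟨v₁, w⟩, …, ⟨v_m, w⟩)`. -/
def cylinder {m : ℕ} (f : (Fin m → ℝ) → ℝ) (v : Fin m → StrongDual ℝ W) (w : W) : ℝ :=
  f (fun l => v l w)

/-- The gradient `∑ₖ ∂ₖ f (⟨v₁, w⟩, …, ⟨v_m, w⟩) j(vₖ) ∈ H` of a cylindrical function. -/
def cylinderGrad (i : H →L[ℝ] W) {m : ℕ} (f : (Fin m → ℝ) → ℝ) (v : Fin m → StrongDual ℝ W)
    (w : W) : H :=
  ∑ k, (fderiv ℝ f (fun l => v l w) (Pi.single k 1)) • dualEmb i (v k)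

/-- `X` is a version of the divergence `δu`: `u ∈ L²(μ; H)`, `X ∈ L²(μ)`, and
`E[(∇φ, u)_H] = E[φ X]` for every smooth cylindrical function `φ`. -/
structure HasDivergence [MeasurableSpace W] (i : H →L[ℝ] W) (μ : Measure W)
    (u : W → H) (X : W → ℝ) : Prop where
  memLp_field : MemLp u 2 μ
  memLp_div : MemLp X 2 μ
  integral_eq : ∀ (m : ℕ) (f : (Fin m → ℝ) → ℝ) (v : Fin m → StrongDual ℝ W),
    ContDiff ℝ ∞ f → HasCompactSupport f →
      ∫ w, inner ℝ (cylinderGrad i f v w) (u w) ∂μ = ∫ w, cylinder f v w * X w ∂μ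

/-- `u` belongs to the domain of the divergence operator, the adjoint of the gradient. -/
def MemDivergenceDomain [MeasurableSpace W] (i : H →L[ℝ] W) (μ : Measure W) (u : W → H) : Prop :=
  ∃ X, HasDivergence i μ u X

open Classical in
/-- The divergence `δu` (a chosen version; it is `0` outside the domain). -/
def divergence [MeasurableSpace W] (i : H →L[ℝ] W) (μ : Measure W) (u : W → H) : W → ℝ :=
  if hu : MemDivergenceDomain i μ u then hu.choose else 0

/-- `R` is a random isometry of `H`: a strongly measurable random bounded operator such that, for
every `h`, `|R(w) h| = |h|` almost surely. -/
structure IsRandomIsometry [MeasurableSpace W] (μ : Measure W) (R : W → H →L[ℝ] H) : Prop where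
  aestronglyMeasurable : ∀ h : H, AEStronglyMeasurable (fun w => R w h) μ
  norm_eq : ∀ h : H, ∀ᵐ w ∂μ, ‖R w h‖ = ‖h‖

/-- `T` is a measure preserving transformation of `W` defined by the random isometry `R`:
`δh ∘ T = δ(R h)` almost surely, for every `h ∈ H`. -/
structure IsRotationOf [MeasurableSpace W] (i : H →L[ℝ] W) (μ : Measure W)
    (R : W → H →L[ℝ] H) (T : W → W) : Prop where
  measurePreserving : MeasurePreserving T μ μ
  divergence_comp : ∀ h : H,
    (fun w => divergence i μ (fun _ => h) (T w)) =ᵐ[μ] divergence i μ (fun w => R w h)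

end

/-- Strong mixing of a sequence of transformations: `E[F · G ∘ Tₙ] → E[F] E[G]` for all
square integrable `F` and `G`. -/
def StronglyMixing {Ω : Type*} [MeasurableSpace Ω] (μ : Measure Ω) (T : ℕ → Ω → Ω) : Prop :=
  ∀ F G : Ω → ℝ, MemLp F 2 μ → MemLp G 2 μ →
    Tendsto (fun n => ∫ w, F w * G (T n w) ∂μ) atTop (𝓝 ((∫ w, F w ∂μ) * ∫ w, G w ∂μ))

end WienerSpace

/-! Existence. By uniqueness of divergences, `δ(R (j e))` is almost surely linear in `e`, and it is
`N(0, |j e|²)`, the law of `e` itself. By Cramér–Wold, for any sequence `e k` in the dual the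
families `δ(R (j (e k)))` and `e k` have the same joint law (`map_divergence_eq`). If the `e k`
separate points, `w ↦ (e k w)` is a Borel embedding, and composing its inverse with the first family
gives `T`. Density of `j(W*)` in `H` and `L²` limits then reach every `δh`; the separating sequence
also gives uniqueness.

Mixing. The operators `G ↦ G ∘ T n - E[G]` are uniformly bounded on `L²(μ)`, so total families of
test functions suffice: `cos e`, `sin e` for `F` and `exp (-e')` for `G`. Girsanov's formula with `h
= j e'`, applied to `g ∘ e`, gives for every `n` the exact factorization `E[g(e + a n) exp(-e' ∘ T
n)] = E[g(e)] E[exp(-e')]`, where `a n = (Q n (j e'), j e)`. Since `a n → 0` in probability and `g`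
is bounded and Lipschitz, removing the shift costs an error that tends to `0`
(`tendsto_integral_mul_exp_comp`). -/

namespace WienerSpace

section Embedding

variable {W H : Type*} [NormedAddCommGroup W] [NormedSpace ℝ W]
  [NormedAddCommGroup H] [InnerProductSpace ℝ H] [CompleteSpace H]

theorem inner_dualEmb (i : H →L[ℝ] W) (e : StrongDual ℝ W) (h : H) :
    inner ℝ (dualEmb i e) h = e (i h) := by
  simp [dualEmb]

theorem dualEmb_add (i : H →L[ℝ] W) (e e' : StrongDual ℝ W) :
    dualEmb i (e + e') = dualEmb i e + dualEmb i e' := by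
  refine ext_inner_right ℝ fun h => ?_
  simp [inner_dualEmb, inner_add_left]

theorem dualEmb_smul (i : H →L[ℝ] W) (c : ℝ) (e : StrongDual ℝ W) :
    dualEmb i (c • e) = c • dualEmb i e := by
  refine ext_inner_right ℝ fun h => ?_
  simp [inner_dualEmb, inner_smul_left]

theorem dualEmb_sub (i : H →L[ℝ] W) (e e' : StrongDual ℝ W) :
    dualEmb i (e - e') = dualEmb i e - dualEmb i e' := by
  refine ext_inner_right ℝ fun h => ?_
  simp [inner_dualEmb, inner_sub_left]

end Embedding

/-! ### Gaussian calculus on the dual and the Cameron–Martin formula. -/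

namespace IsAbstractWienerSpace

variable {W H : Type*} [NormedAddCommGroup W] [NormedSpace ℝ W]
  [MeasurableSpace W] [NormedAddCommGroup H] [InnerProductSpace ℝ H] [CompleteSpace H]
  {i : H →L[ℝ] W} {μ : Measure W}

theorem charFunDual_eq (hW : IsAbstractWienerSpace i μ) (e : StrongDual ℝ W) :
    charFunDual μ e = Complex.exp ((-(‖dualEmb i e‖ ^ 2) / 2 : ℝ) : ℂ) := by
  rw [charFunDual_apply, ← hW.charFun_eq]
  simp_rw [mul_comm]

variable [BorelSpace W]

theorem map_eq_gaussianReal (hW : IsAbstractWienerSpace i μ) (e : StrongDual ℝ W) :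
    μ.map e = gaussianReal 0 (‖dualEmb i e‖₊ ^ 2) := by
  have := hW.isProbabilityMeasure
  refine Measure.ext_of_charFun (funext fun t => ?_)
  rw [charFun_map_eq_charFunDual_smul, hW.charFunDual_eq, charFun_gaussianReal, dualEmb_smul]
  simp only [norm_smul, mul_pow]
  congr 1
  simp
  ring

theorem isGaussian (hW : IsAbstractWienerSpace i μ) : IsGaussian μ :=
  isGaussian_of_map_eq_gaussianReal fun e => ⟨_, _, hW.map_eq_gaussianReal e⟩

theorem hasLaw (hW : IsAbstractWienerSpace i μ) (e : StrongDual ℝ W) :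
    HasLaw e (gaussianReal 0 (‖dualEmb i e‖₊ ^ 2)) μ :=
  ⟨by fun_prop, hW.map_eq_gaussianReal e⟩

theorem memLp_dual (hW : IsAbstractWienerSpace i μ) (e : StrongDual ℝ W) : MemLp e 2 μ := by
  have := hW.isGaussian
  exact IsGaussian.memLp_dual μ e 2 (by simp)

theorem integral_dual (hW : IsAbstractWienerSpace i μ) (e : StrongDual ℝ W) :
    ∫ w, e w ∂μ = 0 := by
  rw [(hW.hasLaw e).integral_eq]
  simp

theorem integral_sq (hW : IsAbstractWienerSpace i μ) (e : StrongDual ℝ W) :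
    ∫ w, e w ^ 2 ∂μ = ‖dualEmb i e‖ ^ 2 := by
  have h := (hW.hasLaw e).variance_eq
  rw [variance_eq_integral (by fun_prop), hW.integral_dual] at h
  simpa using h

theorem integral_mul_dual (hW : IsAbstractWienerSpace i μ) (e e' : StrongDual ℝ W) :
    ∫ w, e w * e' w ∂μ = inner ℝ (dualEmb i e) (dualEmb i e') := by
  have h := hW.integral_sq (e + e')
  have h1 : ∫ w, (e + e') w ^ 2 ∂μ
      = ∫ w, e w ^ 2 ∂μ + 2 * ∫ w, e w * e' w ∂μ + ∫ w, e' w ^ 2 ∂μ := by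
    have h2 := (hW.memLp_dual e).integrable_sq
    have h3 := (hW.memLp_dual e').integrable_sq
    have h4 : Integrable (fun w => e w * e' w) μ :=
      (hW.memLp_dual e).integrable_mul (hW.memLp_dual e')
    rw [← integral_const_mul, ← integral_add h2 (h4.const_mul 2),
      ← integral_add (f := fun w => e w ^ 2 + 2 * (e w * e' w)) (h2.add (h4.const_mul 2)) h3]
    refine integral_congr_ae (.of_forall fun w => ?_)
    simp
    ring
  rw [h1, hW.integral_sq, hW.integral_sq, dualEmb_add, norm_add_sq_real] at h
  linarith

theorem covariance_dual (hW : IsAbstractWienerSpace i μ) (e e' : StrongDual ℝ W) :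
    cov[e, e'; μ] = inner ℝ (dualEmb i e) (dualEmb i e') := by
  rw [covariance, hW.integral_dual, hW.integral_dual]
  simpa using hW.integral_mul_dual e e'

theorem integral_exp (hW : IsAbstractWienerSpace i μ) (e : StrongDual ℝ W) :
    ∫ w, Real.exp (e w) ∂μ = Real.exp (‖dualEmb i e‖ ^ 2 / 2) := by
  have h := mgf_gaussianReal (hW.map_eq_gaussianReal e) 1
  simpa [mgf] using h

theorem integrable_exp (hW : IsAbstractWienerSpace i μ) (e : StrongDual ℝ W) :
    Integrable (fun w => Real.exp (e w)) μ := by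
  -- The integral of a non-integrable function is `0` by convention, whereas this one is positive.
  by_contra h
  have := hW.integral_exp e
  rw [integral_undef h] at this
  exact (Real.exp_pos _).ne this

theorem indepFun (hW : IsAbstractWienerSpace i μ) [CompleteSpace W]
    [SecondCountableTopology W] (e e' : StrongDual ℝ W)
    (h : inner ℝ (dualEmb i e) (dualEmb i e') = 0) : IndepFun e e' μ := by
  have := hW.isGaussian
  refine HasGaussianLaw.indepFun_of_covariance_eq_zero ⟨?_⟩ ?_
  · change IsGaussian (μ.map (e.prod e'))
    infer_instance
  · rw [hW.covariance_dual, h]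

/-- Split `v` into a multiple of `e` and a part whose image in `H` is orthogonal to `j e`: the two
parts are independent, and each factor is a one-dimensional Gaussian transform. -/
theorem integral_cexp_mul_exp (hW : IsAbstractWienerSpace i μ) [CompleteSpace W]
    [SecondCountableTopology W] (v e : StrongDual ℝ W) :
    ∫ w, Complex.exp (v w * Complex.I) * Complex.exp (e w) ∂μ
      = Complex.exp (‖dualEmb i e‖ ^ 2 / 2 - ‖dualEmb i v‖ ^ 2 / 2
          + inner ℝ (dualEmb i v) (dualEmb i e) * Complex.I) := by
  have := hW.isProbabilityMeasure
  -- Coefficient of the projection of `j v` on `j e`. If `j e = 0`, division by zero gives `c = 0`,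
  -- and `hce` still holds.
  set c : ℝ := inner ℝ (dualEmb i v) (dualEmb i e) / ‖dualEmb i e‖ ^ 2 with hc
  have hce : c * ‖dualEmb i e‖ ^ 2 = inner ℝ (dualEmb i v) (dualEmb i e) := by
    by_cases h0 : dualEmb i e = 0
    · simp [h0]
    · rw [hc, div_mul_cancel₀]
      simpa using h0
  have horth : inner ℝ (dualEmb i (v - c • e)) (dualEmb i e) = 0 := by
    rw [dualEmb_sub, dualEmb_smul, inner_sub_left, real_inner_smul_left,
      real_inner_self_eq_norm_sq, hce, sub_self]
  have hind := hW.indepFun _ _ horth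
  have hnorm : ‖dualEmb i (v - c • e)‖ ^ 2 = ‖dualEmb i v‖ ^ 2 - c ^ 2 * ‖dualEmb i e‖ ^ 2 := by
    have : dualEmb i v = dualEmb i (v - c • e) + c • dualEmb i e := by
      rw [dualEmb_sub, dualEmb_smul]; abel
    rw [this, norm_add_sq_real, real_inner_smul_right, horth, norm_smul, mul_pow]
    simp
  have h1 : ∫ w, Complex.exp (v w * Complex.I) * Complex.exp (e w) ∂μ
      = (∫ w, Complex.exp ((v - c • e) w * Complex.I) ∂μ)
        * ∫ w, Complex.exp ((1 + c * Complex.I) * e w) ∂μ := by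
    have := (hind.comp (φ := fun x : ℝ => Complex.exp (x * Complex.I))
      (ψ := fun x : ℝ => Complex.exp ((1 + c * Complex.I) * x)) (by fun_prop)
      (by fun_prop)).integral_fun_mul_eq_mul_integral (by fun_prop) (by fun_prop)
    simp only [Function.comp_apply] at this
    rw [← this]
    refine integral_congr_ae (.of_forall fun w => ?_)
    simp only [← Complex.exp_add]
    congr 1
    simp
    ring
  have h2 : ∫ w, Complex.exp ((1 + c * Complex.I) * e w) ∂μ
      = Complex.exp ((1 + c * Complex.I) ^ 2 * ‖dualEmb i e‖ ^ 2 / 2) := by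
    have := complexMGF_gaussianReal (hW.map_eq_gaussianReal e) (1 + c * Complex.I)
    rw [complexMGF] at this
    rw [this]
    congr 1
    simp
    ring
  rw [h1, ← charFunDual_apply, hW.charFunDual_eq, h2, hnorm, ← hce, ← Complex.exp_add]
  congr 1
  push_cast
  linear_combination (c ^ 2 * ‖dualEmb i e‖ ^ 2 / 2 : ℂ) * Complex.I_sq

/-- Both measures have the characteristic function of `μ` multiplied by the phase `exp (√-1 (j v, j
e))`. -/
theorem map_add_dualEmb (hW : IsAbstractWienerSpace i μ) [CompleteSpace W]
    [SecondCountableTopology W] (e : StrongDual ℝ W) :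
    μ.map (· + i (dualEmb i e)) = μ.tilted e := by
  have := hW.isProbabilityMeasure
  have : IsProbabilityMeasure (μ.tilted e) := isProbabilityMeasure_tilted (hW.integrable_exp e)
  have : IsProbabilityMeasure (μ.map (· + i (dualEmb i e))) :=
    Measure.isProbabilityMeasure_map (by fun_prop)
  refine Measure.ext_of_charFunDual (funext fun v => ?_)
  rw [charFunDual_map_add_const, hW.charFunDual_eq, charFunDual_apply, integral_tilted,
    hW.integral_exp, ← Complex.exp_add]
  have : ∀ w, (Real.exp (e w) / Real.exp (‖dualEmb i e‖ ^ 2 / 2)) • Complex.exp (v w * Complex.I)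
      = Complex.exp (-(‖dualEmb i e‖ ^ 2 / 2))
        * (Complex.exp (v w * Complex.I) * Complex.exp (e w)) := fun w => by
    rw [← Real.exp_sub, Complex.real_smul]
    push_cast
    rw [← Complex.exp_add, ← Complex.exp_add, ← Complex.exp_add]
    congr 1
    ring
  simp_rw [this]
  rw [integral_const_mul, hW.integral_cexp_mul_exp, ← Complex.exp_add, ← inner_dualEmb]
  congr 1
  push_cast
  ring

/-- The Cameron–Martin formula in the directions `j e`. -/
theorem integral_add_dualEmb (hW : IsAbstractWienerSpace i μ) [CompleteSpace W]
    [SecondCountableTopology W] (e : StrongDual ℝ W) {F : W → ℝ} (hF : Continuous F) :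
    ∫ w, F (w + i (dualEmb i e)) ∂μ
      = ∫ w, F w * Real.exp (e w - ‖dualEmb i e‖ ^ 2 / 2) ∂μ := by
  have h : ∫ w, F w ∂(μ.map (· + i (dualEmb i e))) = ∫ w, F w ∂(μ.tilted e) := by
    rw [hW.map_add_dualEmb]
  rw [integral_map (by fun_prop) hF.aestronglyMeasurable, integral_tilted, hW.integral_exp] at h
  rw [h]
  refine integral_congr_ae (.of_forall fun w => ?_)
  simp only [Real.exp_sub, smul_eq_mul]
  ring

end IsAbstractWienerSpace

/-! ### Signed densities as differences of finite measures. -/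

section PositivePart

variable {Ω : Type*} [MeasurableSpace Ω] {μ : Measure Ω}

/-- The finite measure with density the positive part of `X`. -/
noncomputable def posPartMeasure (μ : Measure Ω) (X : Ω → ℝ) : Measure Ω :=
  μ.withDensity fun w => ((X w).toNNReal : ENNReal)

theorem isFiniteMeasure_posPartMeasure {X : Ω → ℝ} (hX : Integrable X μ) :
    IsFiniteMeasure (posPartMeasure μ X) :=
  isFiniteMeasure_withDensity_ofReal hX.2

theorem integrable_posPartMeasure {E : Type*} [NormedAddCommGroup E] [NormedSpace ℝ E]
    {X : Ω → ℝ} (hX : AEMeasurable X μ) {g : Ω → E} (hg : AEStronglyMeasurable g μ)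
    (hgX : Integrable (fun w => X w • g w) μ) : Integrable g (posPartMeasure μ X) := by
  rw [posPartMeasure, integrable_withDensity_iff_integrable_smul₀ hX.real_toNNReal]
  refine hgX.mono (hX.real_toNNReal.aestronglyMeasurable.smul hg) (.of_forall fun w => ?_)
  rw [NNReal.smul_def, norm_smul, norm_smul]
  gcongr
  simp only [Real.coe_toNNReal', Real.norm_eq_abs]
  rw [abs_of_nonneg (le_max_right _ _)]
  exact max_le (le_abs_self _) (abs_nonneg _)

theorem integral_posPartMeasure_sub {E : Type*} [NormedAddCommGroup E] [NormedSpace ℝ E]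
    {X : Ω → ℝ} (hX : AEMeasurable X μ) {g : Ω → E} (hg : AEStronglyMeasurable g μ)
    (hgX : Integrable (fun w => X w • g w) μ) :
    ∫ w, g w ∂(posPartMeasure μ X) - ∫ w, g w ∂(posPartMeasure μ (-X)) = ∫ w, X w • g w ∂μ := by
  have h1 := integrable_posPartMeasure hX hg hgX
  have h2 := integrable_posPartMeasure (X := -X) hX.neg hg (by simpa using hgX.neg)
  rw [posPartMeasure, integrable_withDensity_iff_integrable_smul₀
    (AEMeasurable.real_toNNReal (by fun_prop))] at h1 h2
  rw [posPartMeasure, posPartMeasure, integral_withDensity_eq_integral_smul₀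
    (AEMeasurable.real_toNNReal (by fun_prop)), integral_withDensity_eq_integral_smul₀
    (AEMeasurable.real_toNNReal (by fun_prop)), ← integral_sub h1 h2]
  refine integral_congr_ae (.of_forall fun w => ?_)
  simp only [NNReal.smul_def, ← sub_smul, Real.coe_toNNReal', Pi.neg_apply]
  congr 1
  rcases le_total 0 (X w) with h | h
  · rw [max_eq_left h, max_eq_right (by linarith), sub_zero]
  · rw [max_eq_right h, max_eq_left (by linarith), zero_sub, neg_neg]

/-- Equal measures have almost everywhere equal densities, and at each point one of `X⁺`, `X⁻`
vanishes. -/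
theorem ae_eq_zero_of_posPartMeasure_eq {X : Ω → ℝ} (hX : Integrable X μ)
    (h : posPartMeasure μ X = posPartMeasure μ (-X)) : X =ᵐ[μ] 0 := by
  have := isFiniteMeasure_posPartMeasure hX
  have h1 := (withDensity_eq_iff (by exact hX.aemeasurable.real_toNNReal.coe_nnreal_ennreal)
    (by exact hX.neg.aemeasurable.real_toNNReal.coe_nnreal_ennreal)
    (by
      have := (measure_lt_top (posPartMeasure μ X) Set.univ).ne
      rwa [posPartMeasure, withDensity_apply _ MeasurableSet.univ, setLIntegral_univ] at this)).1 h
  filter_upwards [h1] with w hw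
  rw [ENNReal.coe_inj, ← NNReal.coe_inj] at hw
  simp only [Real.coe_toNNReal', Pi.neg_apply] at hw
  rcases le_total 0 (X w) with h | h
  · rw [max_eq_left h, max_eq_right (by linarith)] at hw
    simpa using hw
  · rw [max_eq_right h, max_eq_left (by linarith)] at hw
    simp
    linarith

end PositivePart

/-! ### Totality of trigonometric and exponential functions of the dual. -/

section Totality

variable {W : Type*} [NormedAddCommGroup W] [NormedSpace ℝ W] [CompleteSpace W]
  [SecondCountableTopology W] [MeasurableSpace W] [BorelSpace W] {μ : Measure W}

/-- The hypothesis says that the measures with densities `X⁺` and `X⁻` have the same characteristic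
function. -/
theorem ae_eq_zero_of_integral_cexp_eq_zero {X : W → ℝ} (hX : Integrable X μ)
    (h : ∀ e : StrongDual ℝ W, ∫ w, X w • Complex.exp (e w * Complex.I) ∂μ = 0) :
    X =ᵐ[μ] 0 := by
  have := isFiniteMeasure_posPartMeasure hX
  have := isFiniteMeasure_posPartMeasure hX.neg
  refine ae_eq_zero_of_posPartMeasure_eq hX (Measure.ext_of_charFunDual (funext fun e => ?_))
  rw [← sub_eq_zero, charFunDual_apply, charFunDual_apply, integral_posPartMeasure_sub
    hX.aemeasurable (by fun_prop), h]
  refine hX.norm.mono' (hX.aestronglyMeasurable.smul (by fun_prop)) (.of_forall fun w => ?_)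
  rw [norm_smul, Complex.norm_exp_ofReal_mul_I, mul_one]

theorem ae_eq_zero_of_integral_cos_sin_eq_zero {X : W → ℝ} (hX : Integrable X μ)
    (hcos : ∀ e : StrongDual ℝ W, ∫ w, X w * Real.cos (e w) ∂μ = 0)
    (hsin : ∀ e : StrongDual ℝ W, ∫ w, X w * Real.sin (e w) ∂μ = 0) :
    X =ᵐ[μ] 0 := by
  refine ae_eq_zero_of_integral_cexp_eq_zero hX fun e => ?_
  have hc : Integrable (fun w => X w * Real.cos (e w)) μ :=
    hX.mul_bdd (c := 1) (by fun_prop) (.of_forall fun w => Real.abs_cos_le_one _)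
  have hs : Integrable (fun w => X w * Real.sin (e w)) μ :=
    hX.mul_bdd (c := 1) (by fun_prop) (.of_forall fun w => Real.abs_sin_le_one _)
  have h1 : ∀ w, X w • Complex.exp (e w * Complex.I)
      = ((X w * Real.cos (e w) : ℝ) : ℂ) + ((X w * Real.sin (e w) : ℝ) : ℂ) * Complex.I := by
    intro w
    rw [Complex.exp_mul_I, Complex.real_smul]
    push_cast
    ring
  simp_rw [h1]
  rw [integral_add hc.ofReal (hs.ofReal.mul_const _), integral_mul_const,
    integral_complex_ofReal, integral_complex_ofReal, hcos, hsin]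
  simp

/-- The Laplace transforms of `X⁺ μ` and `X⁻ μ` along `e` are finite and equal on all of `ℝ`;
analytic continuation to `√-1` makes the characteristic functions equal. -/
theorem ae_eq_zero_of_integral_exp_eq_zero {X : W → ℝ} (hX : MemLp X 2 μ) [IsFiniteMeasure μ]
    (hexp : ∀ e : StrongDual ℝ W, MemLp (fun w => Real.exp (e w)) 2 μ)
    (h : ∀ e : StrongDual ℝ W, ∫ w, X w * Real.exp (e w) ∂μ = 0) : X =ᵐ[μ] 0 := by
  have hX1 : Integrable X μ := hX.integrable (by norm_num)
  have hXm := hX1.aemeasurable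
  have := isFiniteMeasure_posPartMeasure hX1
  have := isFiniteMeasure_posPartMeasure hX1.neg
  refine ae_eq_zero_of_posPartMeasure_eq hX1 (Measure.ext_of_charFunDual (funext fun e => ?_))
  have hi : ∀ t : ℝ, Integrable (fun w => X w • Real.exp (t * e w)) μ := fun t =>
    hX.integrable_mul (hexp (t • e))
  have huniv : ∀ Y : W → ℝ, AEMeasurable Y μ → (Y = X ∨ Y = -X) →
      integrableExpSet e (posPartMeasure μ Y) = Set.univ := by
    rintro Y hY (rfl | rfl)
    · exact Set.eq_univ_of_forall fun t => integrable_posPartMeasure hY (by fun_prop) (hi t)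
    · exact Set.eq_univ_of_forall fun t => integrable_posPartMeasure hY (by fun_prop)
        (by simpa using (hi t).neg)
  have hmgf : mgf e (posPartMeasure μ X) = mgf e (posPartMeasure μ (-X)) := by
    funext t
    rw [← sub_eq_zero, mgf, mgf, integral_posPartMeasure_sub hXm (by fun_prop) (hi t)]
    exact h (t • e)
  -- Side condition of the continuation theorem; the value of `mgf` at `0` is the total mass.
  have h0 : posPartMeasure μ X = 0 ↔ posPartMeasure μ (-X) = 0 := by
    have := congrFun hmgf 0
    rw [mgf_zero', mgf_zero'] at this
    rw [← Measure.measure_univ_eq_zero, ← Measure.measure_univ_eq_zero,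
      ← measureReal_eq_zero_iff, ← measureReal_eq_zero_iff, this]
  have := eqOn_complexMGF_of_mgf' hmgf h0 (x := Complex.I) (by
    simp [huniv X hXm (Or.inl rfl)])
  simp only [complexMGF] at this
  simp_rw [charFunDual_apply, mul_comm _ Complex.I]
  exact this

end Totality

/-! ### Cylindrical functions; linearity and uniqueness of the divergence. -/

section Divergence

variable {W H : Type*} [NormedAddCommGroup W] [NormedSpace ℝ W]
  [NormedAddCommGroup H] [InnerProductSpace ℝ H] [CompleteSpace H]
  {i : H →L[ℝ] W}

theorem inner_cylinderGrad {m : ℕ} (f : (Fin m → ℝ) → ℝ) (v : Fin m → StrongDual ℝ W)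
    (w : W) (h : H) :
    inner ℝ (cylinderGrad i f v w) h = fderiv ℝ f (fun l => v l w) (fun l => v l (i h)) := by
  rw [cylinderGrad, sum_inner]
  simp_rw [real_inner_smul_left, inner_dualEmb]
  conv_rhs => rw [← Finset.univ_sum_single (fun l => v l (i h)), map_sum]
  refine Finset.sum_congr rfl fun l _ => ?_
  have : (Pi.single l (v l (i h)) : Fin m → ℝ) = v l (i h) • Pi.single l 1 := by
    rw [← Pi.single_smul]; simp
  rw [this, map_smul, smul_eq_mul, mul_comm]

theorem continuous_cylinder {m : ℕ} {f : (Fin m → ℝ) → ℝ} (hf : ContDiff ℝ ∞ f)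
    (v : Fin m → StrongDual ℝ W) : Continuous (cylinder f v) :=
  hf.continuous.comp (by fun_prop)

theorem continuous_cylinderGrad {m : ℕ} {f : (Fin m → ℝ) → ℝ} (hf : ContDiff ℝ ∞ f)
    (v : Fin m → StrongDual ℝ W) : Continuous (cylinderGrad i f v) := by
  have := hf.continuous_fderiv (by simp)
  unfold cylinderGrad
  fun_prop

theorem exists_norm_cylinder_le {m : ℕ} {f : (Fin m → ℝ) → ℝ} (hf : ContDiff ℝ ∞ f)
    (hs : HasCompactSupport f) (v : Fin m → StrongDual ℝ W) :
    ∃ C, ∀ w, ‖cylinder f v w‖ ≤ C := by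
  obtain ⟨C, hC⟩ := hs.exists_bound_of_continuous hf.continuous
  exact ⟨C, fun w => hC _⟩

theorem exists_norm_cylinderGrad_le {m : ℕ} {f : (Fin m → ℝ) → ℝ} (hf : ContDiff ℝ ∞ f)
    (hs : HasCompactSupport f) (v : Fin m → StrongDual ℝ W) :
    ∃ C, ∀ w, ‖cylinderGrad i f v w‖ ≤ C := by
  obtain ⟨C, hC⟩ := (hs.fderiv (𝕜 := ℝ)).exists_bound_of_continuous
    (hf.continuous_fderiv (by simp))
  refine ⟨∑ k, C * ‖(Pi.single k 1 : Fin m → ℝ)‖ * ‖dualEmb i (v k)‖, fun w => ?_⟩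
  refine (norm_sum_le _ _).trans (Finset.sum_le_sum fun k _ => ?_)
  rw [norm_smul]
  gcongr
  exact ContinuousLinearMap.le_of_opNorm_le _ (hC _) _

variable [MeasurableSpace W] {μ : Measure W}

theorem HasDivergence.const_smul {u : W → H} {X : W → ℝ} (h : HasDivergence i μ u X) (c : ℝ) :
    HasDivergence i μ (fun w => c • u w) (fun w => c * X w) where
  memLp_field := h.memLp_field.const_smul c
  memLp_div := h.memLp_div.const_mul c
  integral_eq m f v hf hs := by
    simp_rw [real_inner_smul_right, mul_left_comm _ c]
    rw [integral_const_mul, integral_const_mul, h.integral_eq m f v hf hs]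

theorem MemDivergenceDomain.hasDivergence {u : W → H} (hu : MemDivergenceDomain i μ u) :
    HasDivergence i μ u (divergence i μ u) := by
  rw [divergence, dif_pos hu]
  exact hu.choose_spec

variable [BorelSpace W] [IsFiniteMeasure μ]

theorem integrable_cylinder_mul {m : ℕ} {f : (Fin m → ℝ) → ℝ} (hf : ContDiff ℝ ∞ f)
    (hs : HasCompactSupport f) (v : Fin m → StrongDual ℝ W) {X : W → ℝ} (hX : MemLp X 2 μ) :
    Integrable (fun w => cylinder f v w * X w) μ := by
  obtain ⟨C, hC⟩ := exists_norm_cylinder_le hf hs v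
  exact (hX.integrable (by norm_num)).bdd_mul (c := C)
    (continuous_cylinder hf v).aestronglyMeasurable (.of_forall hC)

/-- `cos` and `sin` are not compactly supported, so they are reached from the admissible test
functions by smooth cut-off and dominated convergence. -/
theorem integral_mul_eq_zero_of_cylinder {X : W → ℝ} (hX : MemLp X 2 μ)
    (h : ∀ (m : ℕ) (f : (Fin m → ℝ) → ℝ) (v : Fin m → StrongDual ℝ W),
      ContDiff ℝ ∞ f → HasCompactSupport f → ∫ w, cylinder f v w * X w ∂μ = 0)
    {g : ℝ → ℝ} (hg : ContDiff ℝ ∞ g) (hg1 : ∀ x, |g x| ≤ 1) (e : StrongDual ℝ W) :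
    ∫ w, X w * g (e w) ∂μ = 0 := by
  let χ : ℕ → ContDiffBump (0 : Fin 1 → ℝ) := fun n => ⟨n + 1, n + 2, by positivity, by linarith⟩
  let F : ℕ → (Fin 1 → ℝ) → ℝ := fun n x => χ n x * g (x 0)
  have hF : ∀ n, ∫ w, cylinder (F n) (fun _ => e) w * X w ∂μ = 0 := fun n =>
    h 1 (F n) (fun _ => e) ((χ n).contDiff.mul (by fun_prop)) (χ n).hasCompactSupport.mul_right
  have hlim : Tendsto (fun n => ∫ w, cylinder (F n) (fun _ => e) w * X w ∂μ) atTop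
      (𝓝 (∫ w, X w * g (e w) ∂μ)) := by
    refine tendsto_integral_of_dominated_convergence (fun w => ‖X w‖) (fun n => ?_)
      (hX.integrable (by norm_num)).norm (fun n => .of_forall fun w => ?_) (.of_forall fun w => ?_)
    · refine AEStronglyMeasurable.mul (Continuous.aestronglyMeasurable ?_) hX.1
      have := (χ n).continuous
      have := hg.continuous
      unfold cylinder
      fun_prop
    · rw [norm_mul]
      refine mul_le_of_le_one_left (norm_nonneg _) ?_
      simp only [cylinder, F, norm_mul, Real.norm_eq_abs, abs_of_nonneg (χ n).nonneg]
      exact mul_le_one₀ (χ n).le_one (abs_nonneg _) (hg1 _)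
    · obtain ⟨N, hN⟩ := exists_nat_ge ‖fun _ : Fin 1 => e w‖
      refine tendsto_const_nhds.congr' ?_
      filter_upwards [eventually_ge_atTop N] with n hn
      have : χ n (fun _ => e w) = 1 := by
        refine (χ n).one_of_mem_closedBall ?_
        rw [mem_closedBall_zero_iff]
        have : (N : ℝ) ≤ n := by exact_mod_cast hn
        change _ ≤ (n + 1 : ℝ)
        linarith
      simp [cylinder, F, this, mul_comm]
  simp_rw [hF] at hlim
  exact (tendsto_nhds_unique hlim tendsto_const_nhds)

variable [SecondCountableTopology W]

theorem integrable_inner_cylinderGrad {m : ℕ} {f : (Fin m → ℝ) → ℝ} (hf : ContDiff ℝ ∞ f)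
    (hs : HasCompactSupport f) (v : Fin m → StrongDual ℝ W) {u : W → H} (hu : MemLp u 2 μ) :
    Integrable (fun w => inner ℝ (cylinderGrad i f v w) (u w)) μ := by
  obtain ⟨C, hC⟩ := exists_norm_cylinderGrad_le (i := i) hf hs v
  refine ((hu.integrable (by norm_num)).norm.const_mul C).mono'
    ((continuous_cylinderGrad hf v).aestronglyMeasurable.inner hu.1) (.of_forall fun w => ?_)
  refine (norm_inner_le_norm _ _).trans ?_
  gcongr
  exact hC w

theorem HasDivergence.add {u u' : W → H} {X X' : W → ℝ} (h : HasDivergence i μ u X)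
    (h' : HasDivergence i μ u' X') :
    HasDivergence i μ (fun w => u w + u' w) (fun w => X w + X' w) where
  memLp_field := h.memLp_field.add h'.memLp_field
  memLp_div := h.memLp_div.add h'.memLp_div
  integral_eq m f v hf hs := by
    simp_rw [inner_add_right, mul_add]
    rw [integral_add (integrable_inner_cylinderGrad hf hs v h.memLp_field)
      (integrable_inner_cylinderGrad hf hs v h'.memLp_field),
      integral_add (integrable_cylinder_mul hf hs v h.memLp_div)
      (integrable_cylinder_mul hf hs v h'.memLp_div), h.integral_eq m f v hf hs,
      h'.integral_eq m f v hf hs]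

theorem HasDivergence.sub {u u' : W → H} {X X' : W → ℝ} (h : HasDivergence i μ u X)
    (h' : HasDivergence i μ u' X') :
    HasDivergence i μ (fun w => u w - u' w) (fun w => X w - X' w) := by
  simpa [sub_eq_add_neg] using h.add (h'.const_smul (-1))

theorem HasDivergence.sum_smul {ι : Type*} (s : Finset ι) (c : ι → ℝ) {u : ι → W → H}
    {X : ι → W → ℝ} (h : ∀ k, HasDivergence i μ (u k) (X k)) :
    HasDivergence i μ (fun w => ∑ k ∈ s, c k • u k w) (fun w => ∑ k ∈ s, c k * X k w) := by
  classical
  induction s using Finset.induction_on with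
  | empty => exact ⟨by simp, by simp, by simp⟩
  | insert k s hk ih =>
    simp_rw [Finset.sum_insert hk]
    exact ((h k).const_smul (c k)).add ih

variable [CompleteSpace W]

/-- The difference of two versions is orthogonal to all smooth cylindrical functions, hence to every
`cos e` and `sin e`. The choice made in `divergence` is therefore harmless. -/
theorem HasDivergence.unique {u u' : W → H} {X X' : W → ℝ} (h : HasDivergence i μ u X)
    (h' : HasDivergence i μ u' X') (huu : u =ᵐ[μ] u') : X =ᵐ[μ] X' := by
  have hd := h.sub h'
  have h0 : ∀ (m : ℕ) (f : (Fin m → ℝ) → ℝ) (v : Fin m → StrongDual ℝ W),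
      ContDiff ℝ ∞ f → HasCompactSupport f →
        ∫ w, cylinder f v w * (X w - X' w) ∂μ = 0 := by
    intro m f v hf hs
    rw [← hd.integral_eq m f v hf hs]
    refine integral_eq_zero_of_ae ?_
    filter_upwards [huu] with w hw
    simp [hw]
  have := ae_eq_zero_of_integral_cos_sin_eq_zero (hd.memLp_div.integrable (by norm_num))
    (integral_mul_eq_zero_of_cylinder hd.memLp_div h0 Real.contDiff_cos Real.abs_cos_le_one)
    (integral_mul_eq_zero_of_cylinder hd.memLp_div h0 Real.contDiff_sin Real.abs_sin_le_one)
  filter_upwards [this] with w hw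
  exact sub_eq_zero.1 hw

theorem HasDivergence.divergence_eq {u : W → H} {X : W → ℝ} (h : HasDivergence i μ u X) :
    divergence i μ u =ᵐ[μ] X :=
  MemDivergenceDomain.hasDivergence (⟨X, h⟩ : MemDivergenceDomain i μ u) |>.unique h .rfl

end Divergence

/-! ### Divergence of constant fields. -/

namespace IsAbstractWienerSpace

variable {W H : Type*} [NormedAddCommGroup W] [NormedSpace ℝ W] [MeasurableSpace W]
  [NormedAddCommGroup H] [InnerProductSpace ℝ H] [CompleteSpace H]
  {i : H →L[ℝ] W} {μ : Measure W}

/-- A vector `h` orthogonal to the range satisfies `e (i h) = 0` for every `e`, so `i h = 0` by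
Hahn–Banach, and `i` is injective. -/
theorem denseRange_dualEmb (hW : IsAbstractWienerSpace i μ) : DenseRange (dualEmb i) := by
  let J : StrongDual ℝ W →ₗ[ℝ] H :=
    { toFun := dualEmb i, map_add' := dualEmb_add i, map_smul' := dualEmb_smul i }
  have h : (LinearMap.range J)ᗮ = ⊥ := by
    rw [Submodule.eq_bot_iff]
    intro h hh
    refine hW.injective ?_
    rw [map_zero]
    refine SeparatingDual.eq_zero_of_forall_dual_eq_zero (R := ℝ) fun e => ?_
    rw [← inner_dualEmb]
    exact hh _ ⟨e, rfl⟩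
  have := (Submodule.topologicalClosure_eq_top_iff).2 h
  exact (Submodule.dense_iff_topologicalClosure_eq_top).2 this

variable [BorelSpace W]

theorem norm_toLp_dual (hW : IsAbstractWienerSpace i μ) (e : StrongDual ℝ W) :
    ‖(hW.memLp_dual e).toLp e‖ = ‖dualEmb i e‖ := by
  rw [← sq_eq_sq₀ (norm_nonneg _) (norm_nonneg _), ← hW.integral_sq,
    ← real_inner_self_eq_norm_sq, L2.inner_def]
  refine integral_congr_ae ?_
  filter_upwards [(hW.memLp_dual e).coeFn_toLp] with w hw
  simp [hw, sq]

/-- This and the next lemma differentiate the two sides of the Cameron–Martin formula at `t = 0`,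
which yields integration by parts. -/
theorem hasDerivAt_integral_cylinder_add (hW : IsAbstractWienerSpace i μ) {m : ℕ}
    {f : (Fin m → ℝ) → ℝ} (hf : ContDiff ℝ ∞ f) (hs : HasCompactSupport f)
    (v : Fin m → StrongDual ℝ W) (h : H) :
    HasDerivAt (fun t : ℝ => ∫ w, cylinder f v (w + t • i h) ∂μ)
      (∫ w, inner ℝ (cylinderGrad i f v w) h ∂μ) 0 := by
  have := hW.isProbabilityMeasure
  obtain ⟨C, hC⟩ := exists_norm_cylinderGrad_le (i := i) hf hs v
  have hcont := continuous_cylinder hf v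
  have hgrad := continuous_cylinderGrad (i := i) hf v
  have key := hasDerivAt_integral_of_dominated_loc_of_deriv_le (μ := μ) (x₀ := (0 : ℝ))
    (F := fun t w => cylinder f v (w + t • i h))
    (F' := fun t w => inner ℝ (cylinderGrad i f v (w + t • i h)) h)
    (bound := fun _ => C * ‖h‖) (s := Set.univ) univ_mem ?_ ?_ ?_ ?_ (integrable_const _) ?_
  · simpa using key.2
  · exact .of_forall fun t => (hcont.comp (by fun_prop)).aestronglyMeasurable
  · simpa using integrable_cylinder_mul hf hs v (memLp_const (μ := μ) (1 : ℝ))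
  · exact Continuous.aestronglyMeasurable (by fun_prop)
  · refine .of_forall fun w t _ => (norm_inner_le_norm _ _).trans ?_
    gcongr
    exact hC _
  · refine .of_forall fun w t _ => ?_
    rw [inner_cylinderGrad]
    have h1 : HasDerivAt (fun t : ℝ => fun l => v l (w + t • i h)) (fun l => v l (i h)) t := by
      rw [hasDerivAt_pi]
      intro l
      simp only [map_add, map_smul, smul_eq_mul]
      simpa using ((hasDerivAt_id t).mul_const (v l (i h))).const_add (v l w)
    exact ((hf.differentiable (by simp)).differentiableAt.hasFDerivAt.comp_hasDerivAt t h1)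

theorem hasDerivAt_integral_cylinder_mul_exp (hW : IsAbstractWienerSpace i μ) {m : ℕ}
    {f : (Fin m → ℝ) → ℝ} (hf : ContDiff ℝ ∞ f) (hs : HasCompactSupport f)
    (v : Fin m → StrongDual ℝ W) (e : StrongDual ℝ W) {q : ℝ} (hq : 0 ≤ q) :
    HasDerivAt (fun t : ℝ => ∫ w, cylinder f v w * Real.exp (t * e w - t ^ 2 * q / 2) ∂μ)
      (∫ w, cylinder f v w * e w ∂μ) 0 := by
  have := hW.isProbabilityMeasure
  obtain ⟨C, hC⟩ := exists_norm_cylinder_le hf hs v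
  have hcont := continuous_cylinder hf v
  have hC0 : 0 ≤ C := (norm_nonneg _).trans (hC 0)
  have hint : Integrable (fun w => Real.exp (2 * e w) + Real.exp (-(2 * e w))) μ :=
    (hW.integrable_exp ((2 : ℝ) • e)).add (by simpa using hW.integrable_exp (-((2 : ℝ) • e)))
  have key := hasDerivAt_integral_of_dominated_loc_of_deriv_le (μ := μ) (x₀ := (0 : ℝ))
    (F := fun t w => cylinder f v w * Real.exp (t * e w - t ^ 2 * q / 2))
    (F' := fun t w => cylinder f v w * (Real.exp (t * e w - t ^ 2 * q / 2) * (e w - t * q)))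
    -- For `|t| < 1` the exponential is at most `exp |e w|` and the linear factor at most `(1 + q)
    -- exp |e w|`; then `exp (2|x|) ≤ exp (2x) + exp (-2x)`.
    (bound := fun w => C * ((1 + q) * (Real.exp (2 * e w) + Real.exp (-(2 * e w)))))
    (s := Metric.ball 0 1) (Metric.ball_mem_nhds _ one_pos) ?_ ?_ ?_ ?_
    ((hint.const_mul _).const_mul _) ?_
  · simpa using key.2
  · exact .of_forall fun t => Continuous.aestronglyMeasurable (by fun_prop)
  · simpa using integrable_cylinder_mul hf hs v (memLp_const (μ := μ) (1 : ℝ))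
  · exact Continuous.aestronglyMeasurable (by fun_prop)
  · refine .of_forall fun w t ht => ?_
    rw [mem_ball_zero_iff, Real.norm_eq_abs] at ht
    rw [norm_mul]
    gcongr
    · exact hC w
    rw [norm_mul, Real.norm_eq_abs, Real.norm_eq_abs, Real.abs_exp]
    have h1 : Real.exp (t * e w - t ^ 2 * q / 2) ≤ Real.exp |e w| := by
      apply Real.exp_le_exp.2
      have : t * e w ≤ |e w| := by
        refine (le_abs_self _).trans ?_
        rw [abs_mul]
        exact mul_le_of_le_one_left (abs_nonneg _) ht.le
      have : 0 ≤ t ^ 2 * q / 2 := by positivity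
      linarith
    have h2 : |e w - t * q| ≤ (1 + q) * Real.exp |e w| := by
      have h3 : |t * q| ≤ q := by
        rw [abs_mul, abs_of_nonneg hq]
        exact mul_le_of_le_one_left hq ht.le
      have h4 : |e w| ≤ Real.exp |e w| := by linarith [Real.add_one_le_exp |e w|]
      have h5 : 1 ≤ Real.exp |e w| := Real.one_le_exp (abs_nonneg _)
      have h6 := abs_sub (e w) (t * q)
      nlinarith
    have h7 : Real.exp |e w| * Real.exp |e w| ≤ Real.exp (2 * e w) + Real.exp (-(2 * e w)) := by
      rw [← Real.exp_add, ← two_mul]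
      rcases abs_cases (e w) with ⟨h, _⟩ | ⟨h, _⟩ <;> rw [h]
      · linarith [Real.exp_pos (-(2 * e w))]
      · rw [mul_neg]; linarith [Real.exp_pos (2 * e w)]
    calc _ ≤ Real.exp |e w| * ((1 + q) * Real.exp |e w|) := by gcongr
      _ = (1 + q) * (Real.exp |e w| * Real.exp |e w|) := by ring
      _ ≤ _ := by gcongr
  · refine .of_forall fun w t _ => ?_
    refine HasDerivAt.const_mul _ (HasDerivAt.exp ?_)
    have h1 := (hasDerivAt_id t).mul_const (e w)
    have h2 := (((hasDerivAt_id t).pow 2).mul_const q).div_const 2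
    exact (h1.sub h2).congr_deriv (by simp; ring)

variable [CompleteSpace W] [SecondCountableTopology W]

/-- Gaussian integration by parts: the divergence of the constant field `j e` is `e`. -/
theorem hasDivergence_dualEmb (hW : IsAbstractWienerSpace i μ) (e : StrongDual ℝ W) :
    HasDivergence i μ (fun _ => dualEmb i e) e where
  memLp_field := by
    have := hW.isProbabilityMeasure
    exact memLp_const _
  memLp_div := hW.memLp_dual e
  integral_eq m f v hf hs := by
    have h1 := hW.hasDerivAt_integral_cylinder_add hf hs v (dualEmb i e)
    have h2 := hW.hasDerivAt_integral_cylinder_mul_exp hf hs v e (sq_nonneg ‖dualEmb i e‖)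
    refine h1.unique (h2.congr_of_eventuallyEq (.of_forall fun t => ?_))
    have := hW.integral_add_dualEmb (t • e) (continuous_cylinder hf v)
    simpa [dualEmb_smul, norm_smul, mul_pow] using this

/-- The divergence of a constant field is an `L²` limit of elements of the dual of `W`. -/
theorem exists_hasDivergence_const (hW : IsAbstractWienerSpace i μ) (h : H) :
    ∃ (e : ℕ → StrongDual ℝ W) (X : W → ℝ),
      Tendsto (fun n => dualEmb i (e n)) atTop (𝓝 h) ∧ HasDivergence i μ (fun _ => h) X ∧
      Tendsto (fun n => eLpNorm (fun w => e n w - X w) 2 μ) atTop (𝓝 0) := by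
  have := hW.isProbabilityMeasure
  obtain ⟨s, hs, hsh⟩ := mem_closure_iff_seq_limit.1 (hW.denseRange_dualEmb h)
  choose e he using hs
  have heh : Tendsto (fun n => dualEmb i (e n)) atTop (𝓝 h) := by simpa [he] using hsh
  let Y : ℕ → Lp ℝ 2 μ := fun n => (hW.memLp_dual (e n)).toLp (e n)
  have hY : CauchySeq Y := by
    have h1 := heh.cauchySeq
    rw [Metric.cauchySeq_iff] at h1 ⊢
    -- The map `j e ↦ e` is an isometry from `H` into `L²(μ)`.
    have h2 : ∀ m n, dist (Y m) (Y n) = dist (dualEmb i (e m)) (dualEmb i (e n)) := by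
      intro m n
      rw [dist_eq_norm, dist_eq_norm, ← dualEmb_sub, ← hW.norm_toLp_dual, ← MemLp.toLp_sub]
      rfl
    simpa [h2] using h1
  obtain ⟨X, hX⟩ := cauchySeq_tendsto_of_complete hY
  refine ⟨e, X, heh, ⟨memLp_const _, Lp.memLp X, fun m f v hf hs => ?_⟩, ?_⟩
  · obtain ⟨C, hC⟩ := exists_norm_cylinder_le hf hs v
    have hgi : Integrable (cylinderGrad i f v) μ := by
      obtain ⟨C, hC⟩ := exists_norm_cylinderGrad_le (i := i) hf hs v
      exact (integrable_const C).mono' (continuous_cylinderGrad hf v).aestronglyMeasurable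
        (.of_forall hC)
    have hφ : MemLp (cylinder f v) 2 μ :=
      .of_bound (continuous_cylinder hf v).aestronglyMeasurable C (.of_forall hC)
    have hl : ∀ k : H, ∫ w, inner ℝ (cylinderGrad i f v w) k ∂μ
        = inner ℝ k (∫ w, cylinderGrad i f v w ∂μ) := fun k => by
      rw [← integral_inner hgi]
      simp_rw [real_inner_comm]
    have hr : ∀ Z : Lp ℝ 2 μ, ∫ w, cylinder f v w * Z w ∂μ = inner ℝ (hφ.toLp _) Z := fun Z => by
      rw [L2.inner_def]
      refine integral_congr_ae ?_
      filter_upwards [hφ.coeFn_toLp] with w hw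
      simp [hw, mul_comm]
    rw [hl, hr]
    have t1 : Tendsto (fun n => inner ℝ (dualEmb i (e n)) (∫ w, cylinderGrad i f v w ∂μ)) atTop
        (𝓝 (inner ℝ h (∫ w, cylinderGrad i f v w ∂μ))) := heh.inner tendsto_const_nhds
    have t2 : Tendsto (fun n => inner ℝ (hφ.toLp _) (Y n)) atTop (𝓝 (inner ℝ (hφ.toLp _) X)) :=
      tendsto_const_nhds.inner hX
    -- For a fixed test function, the two sides of the duality identity are continuous in the field
    -- and in the divergence, so the identity passes to the limit.
    refine tendsto_nhds_unique (t1.congr fun n => ?_) t2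
    rw [← hl, ← hr, (hW.hasDivergence_dualEmb (e n)).integral_eq m f v hf hs]
    refine integral_congr_ae ?_
    filter_upwards [(hW.memLp_dual (e n)).coeFn_toLp] with w hw
    rw [hw]
  · rw [Lp.tendsto_Lp_iff_tendsto_eLpNorm'] at hX
    refine hX.congr fun n => eLpNorm_congr_ae ?_
    filter_upwards [(hW.memLp_dual (e n)).coeFn_toLp] with w hw
    simp [Y, hw]

theorem hasDivergence_const (hW : IsAbstractWienerSpace i μ) (h : H) :
    HasDivergence i μ (fun _ => h) (divergence i μ fun _ => h) := by
  obtain ⟨_, X, _, hX, _⟩ := hW.exists_hasDivergence_const h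
  exact MemDivergenceDomain.hasDivergence ⟨X, hX⟩

theorem divergence_dualEmb (hW : IsAbstractWienerSpace i μ) (e : StrongDual ℝ W) :
    divergence i μ (fun _ => dualEmb i e) =ᵐ[μ] e := by
  have := hW.isProbabilityMeasure
  exact (hW.hasDivergence_dualEmb e).divergence_eq

theorem exists_tendsto_divergence_const (hW : IsAbstractWienerSpace i μ) (h : H) :
    ∃ e : ℕ → StrongDual ℝ W, Tendsto (fun n => dualEmb i (e n)) atTop (𝓝 h) ∧
      Tendsto (fun n => eLpNorm (fun w => e n w - divergence i μ (fun _ => h) w) 2 μ)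
        atTop (𝓝 0) := by
  have := hW.isProbabilityMeasure
  obtain ⟨e, X, he, hX, hl⟩ := hW.exists_hasDivergence_const h
  refine ⟨e, he, hl.congr fun n => eLpNorm_congr_ae ?_⟩
  filter_upwards [hX.divergence_eq] with w hw
  rw [hw]

end IsAbstractWienerSpace

/-! ### Consequences of the law `N(0, |h|²)`. -/

section GaussianLaw

variable {Ω H : Type*} [MeasurableSpace Ω] {μ : Measure Ω} [NormedAddCommGroup H] {X : Ω → ℝ}
  {h : H}

theorem integral_cexp_of_hasLaw (hX : HasLaw X (gaussianReal 0 (‖h‖₊ ^ 2)) μ) :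
    ∫ w, Complex.exp (X w * Complex.I) ∂μ = Complex.exp ((-(‖h‖ ^ 2) / 2 : ℝ) : ℂ) := by
  have h1 := charFun_gaussianReal (μ := 0) (v := ‖h‖₊ ^ 2) 1
  rw [← hX.map_eq, charFun_apply_real, integral_map hX.aemeasurable (by fun_prop)] at h1
  convert h1 using 2
  · simp
  · simp
    ring

theorem eLpNorm_two_of_hasLaw (hX : HasLaw X (gaussianReal 0 (‖h‖₊ ^ 2)) μ) :
    eLpNorm X 2 μ = ENNReal.ofReal ‖h‖ := by
  have hp : IsProbabilityMeasure μ := by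
    constructor
    have := measure_univ (μ := gaussianReal 0 (‖h‖₊ ^ 2))
    rwa [← hX.map_eq, Measure.map_apply_of_aemeasurable hX.aemeasurable MeasurableSet.univ] at this
  have hL : MemLp X 2 μ := by
    have := memLp_id_gaussianReal (μ := 0) (v := ‖h‖₊ ^ 2) 2
    rw [← hX.map_eq, memLp_map_measure_iff (by fun_prop) hX.aemeasurable] at this
    exact this
  have hm : ∫ w, X w ∂μ = 0 := by rw [hX.integral_eq]; simp
  have hv := hX.variance_eq
  rw [variance_eq_integral hX.aemeasurable, hm] at hv
  have hv' : ∫ w, X w ^ 2 ∂μ = ‖h‖ ^ 2 := by simpa using hv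
  rw [hL.eLpNorm_eq_integral_rpow_norm (by simp) (by simp)]
  simp only [ENNReal.toReal_ofNat, Real.rpow_ofNat, Real.norm_eq_abs, sq_abs, hv']
  rw [← one_div, ← Real.sqrt_eq_rpow, Real.sqrt_sq (norm_nonneg _)]

end GaussianLaw

section Separation

variable {W : Type*} [NormedAddCommGroup W] [NormedSpace ℝ W] [TopologicalSpace.SeparableSpace W]

/-- The dual of a separable normed space contains a sequence separating points. -/
theorem exists_seq_dual_separating :
    ∃ e : ℕ → StrongDual ℝ W, ∀ x, (∀ k, e k x = 0) → x = 0 := by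
  choose e he1 he2 using fun k =>
    exists_dual_vector'' ℝ (TopologicalSpace.denseSeq W k)
  refine ⟨e, fun x hx => ?_⟩
  by_contra h0
  obtain ⟨k, hk⟩ := (TopologicalSpace.denseRange_denseSeq W).exists_dist_lt x
    (half_pos (norm_pos_iff.2 h0))
  set y := TopologicalSpace.denseSeq W k
  -- `e k` norms `y` and kills `x`. With `‖x - y‖ < ‖x‖ / 2` this contradicts the triangle
  -- inequality.
  have h1 : ‖y‖ ≤ ‖x - y‖ := by
    have h2 : ‖y‖ = e k (y - x) := by rw [map_sub, hx, sub_zero, he2]; rfl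
    rw [h2, norm_sub_rev]
    refine (le_abs_self _).trans (((e k).le_opNorm _).trans ?_)
    exact mul_le_of_le_one_left (norm_nonneg _) (he1 k)
  rw [dist_eq_norm] at hk
  have := norm_le_norm_add_norm_sub y x
  rw [norm_sub_rev] at hk h1
  linarith

end Separation

/-! ### Existence and uniqueness of the transformation. -/

section Rotation

variable {W H : Type*} [NormedAddCommGroup W] [NormedSpace ℝ W] [CompleteSpace W]
  [SecondCountableTopology W] [MeasurableSpace W] [BorelSpace W]
  [NormedAddCommGroup H] [InnerProductSpace ℝ H] [CompleteSpace H]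
  {i : H →L[ℝ] W} {μ : Measure W} {R : W → H →L[ℝ] H}

theorem divergence_sub [IsFiniteMeasure μ]
    (hdom : ∀ h : H, MemDivergenceDomain i μ (fun w => R w h)) (h k : H) :
    divergence i μ (fun w => R w (h - k)) =ᵐ[μ]
      fun w => divergence i μ (fun w => R w h) w - divergence i μ (fun w => R w k) w := by
  refine HasDivergence.divergence_eq ?_
  simpa using (hdom h).hasDivergence.sub (hdom k).hasDivergence

theorem divergence_sum_smul [IsFiniteMeasure μ] {ι : Type*}
    (hdom : ∀ h : H, MemDivergenceDomain i μ (fun w => R w h)) (s : Finset ι) (c : ι → ℝ)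
    (h : ι → H) :
    divergence i μ (fun w => R w (∑ k ∈ s, c k • h k)) =ᵐ[μ]
      fun w => ∑ k ∈ s, c k * divergence i μ (fun w => R w (h k)) w := by
  refine HasDivergence.divergence_eq ?_
  simpa using HasDivergence.sum_smul s c fun k => (hdom (h k)).hasDivergence

/-- Cramér–Wold: a finite combination of the `δ(R (j (e k)))` is the divergence of `R` applied to
the same combination of the `j (e k)`, so its Gaussian law is prescribed. -/
theorem IsAbstractWienerSpace.map_divergence_eq (hW : IsAbstractWienerSpace i μ)
    (hdom : ∀ h : H, MemDivergenceDomain i μ (fun w => R w h))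
    (hgauss : ∀ h : H,
      HasLaw (divergence i μ (fun w => R w h)) (gaussianReal 0 (‖h‖₊ ^ 2)) μ)
    (e : ℕ → StrongDual ℝ W) :
    μ.map (fun w k => divergence i μ (fun w => R w (dualEmb i (e k))) w)
      = μ.map (fun w k => e k w) := by
  have := hW.isProbabilityMeasure
  have hY : AEMeasurable (fun w k => divergence i μ (fun w => R w (dualEmb i (e k))) w) μ :=
    aemeasurable_pi_lambda _ fun k => (hgauss _).aemeasurable
  have hZ : AEMeasurable (fun w k => e k w) μ := by fun_prop
  rw [map_eq_iff_forall_finset_map_restrict_eq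
    (X := fun k w => divergence i μ (fun w => R w (dualEmb i (e k))) w)
    (Y := fun k w => e k w) hY hZ]
  intro I
  have hYI : AEMeasurable
      (fun w => I.restrict fun k => divergence i μ (fun w => R w (dualEmb i (e k))) w) μ :=
    (Finset.measurable_restrict I).comp_aemeasurable hY
  have hZI : AEMeasurable (fun w => I.restrict fun k => e k w) μ :=
    (Finset.measurable_restrict I).comp_aemeasurable hZ
  have := Measure.isProbabilityMeasure_map hYI
  have := Measure.isProbabilityMeasure_map hZI
  refine Measure.ext_of_charFunDual (funext fun L => ?_)
  rw [charFunDual_apply, charFunDual_apply, integral_map hYI (by fun_prop),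
    integral_map hZI (by fun_prop)]
  set c : I → ℝ := fun k => L (Pi.single k 1)
  have hL : ∀ x, L x = ∑ k, c k * x k := fun x => by
    conv_lhs => rw [← Finset.univ_sum_single x, map_sum]
    refine Finset.sum_congr rfl fun k _ => ?_
    have : (Pi.single k (x k) : I → ℝ) = x k • Pi.single k 1 := by rw [← Pi.single_smul]; simp
    rw [this, map_smul, smul_eq_mul, mul_comm]
  have hj : ∀ s : Finset I, dualEmb i (∑ k ∈ s, c k • e k) = ∑ k ∈ s, c k • dualEmb i (e k) := by
    intro s
    refine ext_inner_right ℝ fun h => ?_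
    simp [sum_inner, inner_smul_left, inner_dualEmb]
  have h1 := integral_cexp_of_hasLaw (hgauss (∑ k : I, c k • dualEmb i (e k)))
  have h2 := integral_cexp_of_hasLaw (hW.hasLaw (∑ k : I, c k • e k))
  rw [hj, ← h1] at h2
  simp only [hL]
  refine Eq.trans (integral_congr_ae ?_) (h2.symm.trans (integral_congr_ae (.of_forall fun w => ?_)))
  · filter_upwards [divergence_sum_smul hdom Finset.univ c fun k : I => dualEmb i (e k)] with w hw
    rw [hw]
    rfl
  · simp

/-- `e n ∘ T` has two `L²` limits: `δh ∘ T`, because `T` preserves `μ`, and `δ(R h)`, because `δ(R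
(j (e n) - h))` has `L²` norm `|j (e n) - h|`. -/
theorem IsAbstractWienerSpace.divergence_comp_of_dualEmb (hW : IsAbstractWienerSpace i μ)
    (hdom : ∀ h : H, MemDivergenceDomain i μ (fun w => R w h))
    (hgauss : ∀ h : H,
      HasLaw (divergence i μ (fun w => R w h)) (gaussianReal 0 (‖h‖₊ ^ 2)) μ)
    {T : W → W} (hT : MeasurePreserving T μ μ) (e : ℕ → StrongDual ℝ W) {h : H}
    (he : ∀ n, e n ∘ T =ᵐ[μ] divergence i μ (fun w => R w (dualEmb i (e n))))
    (heh : Tendsto (fun n => dualEmb i (e n)) atTop (𝓝 h))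
    (hlim : Tendsto (fun n => eLpNorm (fun w => e n w - divergence i μ (fun _ => h) w) 2 μ)
      atTop (𝓝 0)) :
    (fun w => divergence i μ (fun _ => h) (T w)) =ᵐ[μ] divergence i μ (fun w => R w h) := by
  have := hW.isProbabilityMeasure
  have hm := (hW.hasDivergence_const h).memLp_div.1
  have h1 : TendstoInMeasure μ (fun n => e n ∘ T) atTop
      (fun w => divergence i μ (fun _ => h) (T w)) := by
    refine tendstoInMeasure_of_tendsto_eLpNorm (p := 2) (by simp)
      (fun n => ((e n).continuous.measurable.comp hT.measurable).aestronglyMeasurable)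
      (hm.comp_measurePreserving hT) (hlim.congr fun n => ?_)
    exact (eLpNorm_comp_measurePreserving ((e n).continuous.aestronglyMeasurable.sub hm) hT).symm
  have h2 : TendstoInMeasure μ (fun n => e n ∘ T) atTop (divergence i μ (fun w => R w h)) := by
    refine tendstoInMeasure_of_tendsto_eLpNorm (p := 2) (by simp)
      (fun n => ((e n).continuous.measurable.comp hT.measurable).aestronglyMeasurable)
      (hdom h).hasDivergence.memLp_div.1 ?_
    have h3 : Tendsto (fun n => ENNReal.ofReal ‖dualEmb i (e n) - h‖) atTop (𝓝 0) := by
      have := ENNReal.tendsto_ofReal (tendsto_iff_norm_sub_tendsto_zero.1 heh)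
      simpa using this
    refine h3.congr fun n => ?_
    rw [← eLpNorm_two_of_hasLaw (hgauss _)]
    refine eLpNorm_congr_ae ?_
    filter_upwards [divergence_sub hdom (dualEmb i (e n)) h, he n] with w hw1 hw2
    rw [hw1, Pi.sub_apply, hw2]
  exact tendstoInMeasure_ae_unique h1 h2

theorem IsAbstractWienerSpace.exists_measurePreserving_dual_comp
    (hW : IsAbstractWienerSpace i μ)
    (hdom : ∀ h : H, MemDivergenceDomain i μ (fun w => R w h))
    (hgauss : ∀ h : H,
      HasLaw (divergence i μ (fun w => R w h)) (gaussianReal 0 (‖h‖₊ ^ 2)) μ)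
    (e : ℕ → StrongDual ℝ W) (he : ∀ x, (∀ k, e k x = 0) → x = 0) :
    ∃ T : W → W, MeasurePreserving T μ μ ∧
      ∀ k, e k ∘ T =ᵐ[μ] divergence i μ (fun w => R w (dualEmb i (e k))) := by
  have hlaw := hW.map_divergence_eq hdom hgauss e
  set Y : W → ℕ → ℝ := fun w k => divergence i μ (fun w => R w (dualEmb i (e k))) w
  set Φ : W → ℕ → ℝ := fun w k => e k w
  have hY : AEMeasurable Y μ := aemeasurable_pi_lambda _ fun k => (hgauss _).aemeasurable
  -- Lusin–Souslin: an injective Borel map between Polish spaces is a measurable embedding.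
  have hΦ : MeasurableEmbedding Φ := by
    refine Measurable.measurableEmbedding (by fun_prop) fun x y hxy => sub_eq_zero.1 (he _ ?_)
    intro k
    rw [map_sub, sub_eq_zero]
    exact congrFun hxy k
  -- `g` is a measurable left inverse of `Φ`. Its values off the range do not matter, since `Y` has
  -- the law of `Φ` and almost surely lands there.
  obtain ⟨g, hg, hgΦ⟩ := hΦ.exists_measurable_extend measurable_id fun _ => ⟨0⟩
  have hYm := hY.measurable_mk
  have hYlaw : μ.map (hY.mk Y) = μ.map Φ := by rw [← Measure.map_congr hY.ae_eq_mk, hlaw]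
  have hrange : ∀ᵐ w ∂μ, hY.mk Y w ∈ Set.range Φ := by
    refine ae_of_ae_map hYm.aemeasurable (p := fun y => y ∈ Set.range Φ) ?_
    rw [hYlaw]
    exact (ae_map_iff hΦ.measurable.aemeasurable hΦ.measurableSet_range).2
      (.of_forall fun w => ⟨w, rfl⟩)
  refine ⟨g ∘ hY.mk Y, ⟨hg.comp hYm, ?_⟩, fun k => ?_⟩
  · rw [← Measure.map_map hg hYm, hYlaw, Measure.map_map hg hΦ.measurable, hgΦ, Measure.map_id]
  · filter_upwards [hrange, hY.ae_eq_mk] with w ⟨x, hx⟩ hw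
    have h1 : g (hY.mk Y w) = x := by
      rw [← hx]
      exact congrFun hgΦ x
    change e k (g (hY.mk Y w)) = Y w k
    rw [h1, hw, ← hx]

theorem IsAbstractWienerSpace.exists_isRotationOf (hW : IsAbstractWienerSpace i μ)
    (hdom : ∀ h : H, MemDivergenceDomain i μ (fun w => R w h))
    (hgauss : ∀ h : H,
      HasLaw (divergence i μ (fun w => R w h)) (gaussianReal 0 (‖h‖₊ ^ 2)) μ) :
    ∃ T : W → W, IsRotationOf i μ R T := by
  have := hW.isProbabilityMeasure
  obtain ⟨e, he⟩ := exists_seq_dual_separating (W := W)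
  obtain ⟨T, hT, hTe⟩ := hW.exists_measurePreserving_dual_comp hdom hgauss e he
  refine ⟨T, hT, fun h => ?_⟩
  have hall : ∀ v : StrongDual ℝ W,
      v ∘ T =ᵐ[μ] divergence i μ (fun w => R w (dualEmb i v)) := by
    intro v
    -- `T` is controlled only along `e`. Adjoining `v` at index `0` gives a map `T'` that also
    -- handles `v`; the `e k` force `T = T'` almost surely.
    obtain ⟨T', _, hTe'⟩ := hW.exists_measurePreserving_dual_comp hdom hgauss
      (fun k => Nat.casesOn k v e) fun x hx => he x fun k => hx (k + 1)
    filter_upwards [ae_all_iff.2 hTe, ae_all_iff.2 hTe'] with w h1 h2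
    have h3 : T w = T' w := by
      rw [← sub_eq_zero]
      refine he _ fun k => ?_
      rw [map_sub, sub_eq_zero]
      exact (h1 k).trans (h2 (k + 1)).symm
    rw [Function.comp_apply, h3]
    exact h2 0
  obtain ⟨v, hv, hlim⟩ := hW.exists_tendsto_divergence_const h
  exact hW.divergence_comp_of_dualEmb hdom hgauss hT v (fun n => hall (v n)) hv hlim

theorem IsRotationOf.dual_comp (hW : IsAbstractWienerSpace i μ) {T : W → W}
    (hT : IsRotationOf i μ R T) (e : StrongDual ℝ W) :
    (fun w => e (T w)) =ᵐ[μ] divergence i μ (fun w => R w (dualEmb i e)) := by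
  filter_upwards [hT.divergence_comp (dualEmb i e),
    hT.measurePreserving.quasiMeasurePreserving.ae (hW.divergence_dualEmb e)] with w h1 h2
  rw [← h1, h2]

theorem IsRotationOf.ae_unique (hW : IsAbstractWienerSpace i μ) {T T' : W → W}
    (hT : IsRotationOf i μ R T) (hT' : IsRotationOf i μ R T') : T =ᵐ[μ] T' := by
  obtain ⟨e, he⟩ := exists_seq_dual_separating (W := W)
  have h1 := ae_all_iff.2 fun k => (hT.dual_comp hW (e k)).trans (hT'.dual_comp hW (e k)).symm
  filter_upwards [h1] with w hw
  rw [← sub_eq_zero]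
  exact he _ fun k => by rw [map_sub, hw k, sub_self]

end Rotation

/-- A bounded sequence of a Hilbert space converges weakly to `0` as soon as it does so against
a total set. -/
theorem tendsto_inner_zero_of_total {E : Type*} [NormedAddCommGroup E] [InnerProductSpace ℝ E]
    [CompleteSpace E] {S : Set E} (hS : ∀ x, (∀ s ∈ S, inner ℝ s x = 0) → x = 0)
    {x : ℕ → E} {C : ℝ} (hC : ∀ n, ‖x n‖ ≤ C)
    (h : ∀ s ∈ S, Tendsto (fun n => inner ℝ s (x n)) atTop (𝓝 0)) (y : E) :
    Tendsto (fun n => inner ℝ y (x n)) atTop (𝓝 0) := by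
  have hC0 : 0 ≤ C := (norm_nonneg _).trans (hC 0)
  let V : Submodule ℝ E :=
    { carrier := {z | Tendsto (fun n => inner ℝ z (x n)) atTop (𝓝 0)}
      add_mem' := fun {a b} ha hb => by
        simpa [inner_add_left] using Tendsto.add ha hb
      zero_mem' := by simp
      smul_mem' := fun c z hz => by
        simpa [real_inner_smul_left] using Tendsto.const_mul c hz }
  have hV : Vᗮ = ⊥ := by
    rw [Submodule.eq_bot_iff]
    exact fun z hz => hS z fun s hs => hz s (h s hs)
  have hd := (Submodule.dense_iff_topologicalClosure_eq_top).2
    ((Submodule.topologicalClosure_eq_top_iff).2 hV)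
  rw [Metric.tendsto_atTop]
  intro ε hε
  obtain ⟨z, hz, hyz⟩ := hd.exists_dist_lt y (ε := ε / (2 * (C + 1))) (by positivity)
  obtain ⟨N, hN⟩ := Metric.tendsto_atTop.1 hz (ε / 2) (by positivity)
  refine ⟨N, fun n hn => ?_⟩
  have h1 := hN n hn
  rw [Real.dist_0_eq_abs] at h1 ⊢
  rw [dist_eq_norm] at hyz
  have h2 : |inner ℝ (y - z) (x n)| ≤ ‖y - z‖ * (C + 1) :=
    (abs_real_inner_le_norm _ _).trans
      (mul_le_mul_of_nonneg_left ((hC n).trans (by linarith)) (norm_nonneg _))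
  have h3 : ‖y - z‖ * (C + 1) < ε / 2 := by
    calc _ < ε / (2 * (C + 1)) * (C + 1) := by gcongr
      _ = ε / 2 := by field_simp
  have h4 : inner ℝ y (x n) = inner ℝ (y - z) (x n) + inner ℝ z (x n) := by
    rw [← inner_add_left, sub_add_cancel]
  rw [h4]
  exact (abs_add_le _ _).trans_lt (by linarith)

/-! ### Estimates in `L²`. -/

section SquareIntegrable

variable {Ω : Type*} [MeasurableSpace Ω] {μ : Measure Ω}

theorem inner_toLp_toLp {f g : Ω → ℝ} (hf : MemLp f 2 μ) (hg : MemLp g 2 μ) :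
    inner ℝ (hf.toLp f) (hg.toLp g) = ∫ w, f w * g w ∂μ := by
  rw [L2.inner_def]
  refine integral_congr_ae ?_
  filter_upwards [hf.coeFn_toLp, hg.coeFn_toLp] with w h1 h2
  simp [h1, h2, mul_comm]

theorem abs_integral_mul_le {f g : Ω → ℝ} (hf : MemLp f 2 μ) (hg : MemLp g 2 μ) :
    |∫ w, f w * g w ∂μ| ≤ √(∫ w, f w ^ 2 ∂μ) * √(∫ w, g w ^ 2 ∂μ) := by
  have h : ∀ {k : Ω → ℝ} (hk : MemLp k 2 μ), √(∫ w, k w ^ 2 ∂μ) = ‖hk.toLp k‖ := fun hk => by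
    rw [← Real.sqrt_sq (norm_nonneg (hk.toLp _)), ← real_inner_self_eq_norm_sq, inner_toLp_toLp]
    simp_rw [sq]
  rw [h hf, h hg, ← inner_toLp_toLp hf hg]
  exact abs_real_inner_le_norm _ _

/-- Every subsequence has a further one along which `a` tends to `0` almost everywhere; dominated
convergence applies there. -/
theorem tendsto_integral_sq_of_tendstoInMeasure [IsFiniteMeasure μ] {a d : ℕ → Ω → ℝ} {C : ℝ}
    (hd : ∀ n, AEStronglyMeasurable (d n) μ) (ha : TendstoInMeasure μ a atTop fun _ => 0)
    (hda : ∀ n w, |d n w| ≤ |a n w|) (hC : ∀ n w, |d n w| ≤ C) :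
    Tendsto (fun n => ∫ w, d n w ^ 2 ∂μ) atTop (𝓝 0) := by
  refine tendsto_of_subseq_tendsto fun ns hns => ?_
  obtain ⟨ms, _, hms⟩ := TendstoInMeasure.exists_seq_tendsto_ae
    (f := fun n => a (ns n)) (fun ε hε => (ha ε hε).comp hns)
  refine ⟨ms, ?_⟩
  rw [← integral_zero Ω ℝ (μ := μ)]
  refine tendsto_integral_of_dominated_convergence (fun _ => C ^ 2) (fun n => (hd _).pow 2)
    (integrable_const _) (fun n => .of_forall fun w => ?_) ?_
  · rw [norm_pow, Real.norm_eq_abs]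
    exact pow_le_pow_left₀ (abs_nonneg _) (hC _ _) 2
  · filter_upwards [hms] with w hw
    have : Tendsto (fun n => d (ns (ms n)) w) atTop (𝓝 0) := by
      refine squeeze_zero_norm (fun n => hda _ w) ?_
      simpa using hw.abs
    simpa using this.pow 2

end SquareIntegrable

/-! ### Strong mixing. -/

section Mixing

variable {W H : Type*} [NormedAddCommGroup W] [NormedSpace ℝ W] [CompleteSpace W]
  [SecondCountableTopology W] [MeasurableSpace W] [BorelSpace W]
  [NormedAddCommGroup H] [InnerProductSpace ℝ H] [CompleteSpace H]
  {i : H →L[ℝ] W} {μ : Measure W}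

omit [CompleteSpace W] [SecondCountableTopology W] in
theorem IsAbstractWienerSpace.memLp_exp (hW : IsAbstractWienerSpace i μ) (e : StrongDual ℝ W) :
    MemLp (fun w => Real.exp (e w)) 2 μ := by
  rw [memLp_two_iff_integrable_sq (Continuous.aestronglyMeasurable (by fun_prop))]
  have := hW.integrable_exp ((2 : ℝ) • e)
  refine this.congr (.of_forall fun w => ?_)
  simp [← Real.exp_nat_mul]

/-- Girsanov's formula for a random isometry, tested on functions of a single functional and
expressed through the rotation it defines. -/
theorem IsRotationOf.integral_add_inner_mul_exp (hW : IsAbstractWienerSpace i μ)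
    {R : W → H →L[ℝ] H} {T : W → W} (hT : IsRotationOf i μ R T)
    (hgirsanov : ∀ (h : H) (F : W →ᵇ ℝ),
      ∫ w, F (w + i (R w h)) *
          Real.exp (-divergence i μ (fun w' => R w' h) w - ‖h‖ ^ 2 / 2) ∂μ = ∫ w, F w ∂μ)
    {g : ℝ → ℝ} (hg : Continuous g) (hg1 : ∀ x, |g x| ≤ 1) (e e' : StrongDual ℝ W) :
    ∫ w, g (e w + inner ℝ (R w (dualEmb i e')) (dualEmb i e)) * Real.exp (-e' (T w)) ∂μ
      = (∫ w, g (e w) ∂μ) * ∫ w, Real.exp (-e' w) ∂μ := by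
  have h1 := hgirsanov (dualEmb i e')
    (BoundedContinuousFunction.ofNormedAddCommGroup (fun w => g (e w)) (by fun_prop) 1
      fun w => hg1 _)
  have h2 := hW.integral_exp (-e')
  have h3 : ‖dualEmb i (-e')‖ = ‖dualEmb i e'‖ := by
    rw [← neg_one_smul ℝ e', dualEmb_smul]; simp
  simp only [neg_apply] at h2
  simp only [BoundedContinuousFunction.coe_ofNormedAddCommGroup] at h1
  -- `E[exp (-e')] = exp (|j e'|² / 2)` cancels the normalizing constant in Girsanov's formula.
  rw [h2, h3, ← h1, ← integral_mul_const]
  refine integral_congr_ae ?_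
  filter_upwards [hT.dual_comp hW e'] with w hw
  rw [← hw, Real.exp_sub, map_add, real_inner_comm, inner_dualEmb]
  field_simp

/-- With the shift by `a n` inside `g` the expectation factorizes exactly; the correction `d n` is
bounded by `|a n|` and by `2`, hence tends to `0` in `L²`. -/
theorem tendsto_integral_mul_exp_comp (hW : IsAbstractWienerSpace i μ)
    {Q : ℕ → W → H →L[ℝ] H} {T : ℕ → W → W} (hQ : ∀ n, IsRandomIsometry μ (Q n))
    (hT : ∀ n, IsRotationOf i μ (Q n) (T n))
    (hgirsanov : ∀ n (h : H) (F : W →ᵇ ℝ),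
      ∫ w, F (w + i (Q n w h)) *
          Real.exp (-divergence i μ (fun w' => Q n w' h) w - ‖h‖ ^ 2 / 2) ∂μ = ∫ w, F w ∂μ)
    (hlim : ∀ h k : H,
        TendstoInMeasure μ (fun n w => inner ℝ (Q n w h) k) atTop (fun _ => (0 : ℝ)))
    {g : ℝ → ℝ} (hg : LipschitzWith 1 g) (hg1 : ∀ x, |g x| ≤ 1) (e e' : StrongDual ℝ W) :
    Tendsto (fun n => ∫ w, g (e w) * Real.exp (-e' (T n w)) ∂μ) atTop
      (𝓝 ((∫ w, g (e w) ∂μ) * ∫ w, Real.exp (-e' w) ∂μ)) := by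
  have := hW.isProbabilityMeasure
  have hgc := hg.continuous
  set a : ℕ → W → ℝ := fun n w => inner ℝ (Q n w (dualEmb i e')) (dualEmb i e)
  have ham : ∀ n, AEStronglyMeasurable (a n) μ := fun n =>
    ((hQ n).aestronglyMeasurable _).inner aestronglyMeasurable_const
  have hem : AEStronglyMeasurable e μ := e.continuous.aestronglyMeasurable
  set d : ℕ → W → ℝ := fun n w => g (e w + a n w) - g (e w)
  have hs : ∀ n, AEStronglyMeasurable (fun w => g (e w + a n w)) μ := fun n =>
    hgc.comp_aestronglyMeasurable (hem.add (ham n))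
  have h0 : AEStronglyMeasurable (fun w => g (e w)) μ := hgc.comp_aestronglyMeasurable hem
  have hdm : ∀ n, AEStronglyMeasurable (d n) μ := fun n => (hs n).sub h0
  have hd2 : ∀ n w, |d n w| ≤ 2 := fun n w =>
    (abs_sub _ _).trans (by linarith [hg1 (e w + a n w), hg1 (e w)])
  have hda : ∀ n w, |d n w| ≤ |a n w| := fun n w => by
    have := hg.dist_le_mul (e w + a n w) (e w)
    simpa [Real.dist_eq] using this
  have hsq := tendsto_integral_sq_of_tendstoInMeasure hdm (hlim _ _) hda hd2
  have hG : MemLp (fun w => Real.exp (-e' w)) 2 μ := hW.memLp_exp (-e')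
  have hGT : ∀ n, MemLp (fun w => Real.exp (-e' (T n w))) 2 μ := fun n =>
    hG.comp_measurePreserving (hT n).measurePreserving
  have hdL : ∀ n, MemLp (d n) 2 μ := fun n => .of_bound (hdm n) 2 (.of_forall (hd2 n))
  have hsmall : Tendsto (fun n => ∫ w, d n w * Real.exp (-e' (T n w)) ∂μ) atTop (𝓝 0) := by
    -- Cauchy–Schwarz bound; since `T n` preserves `μ`, the second factor does not depend on `n`.
    have hb : Tendsto (fun n => √(∫ w, d n w ^ 2 ∂μ) * √(∫ w, Real.exp (-e' w) ^ 2 ∂μ)) atTop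
        (𝓝 0) := by
      simpa using hsq.sqrt.mul_const (√(∫ w, Real.exp (-e' w) ^ 2 ∂μ))
    refine squeeze_zero_norm (fun n => ?_) hb
    refine (abs_integral_mul_le (hdL n) (hGT n)).trans_eq ?_
    congr 2
    have hmap := integral_map (μ := μ) (f := fun w => Real.exp (-e' w) ^ 2)
      (hT n).measurePreserving.measurable.aemeasurable
      (Continuous.aestronglyMeasurable (by fun_prop))
    rw [(hT n).measurePreserving.map_eq] at hmap
    exact hmap.symm
  have hdiff : ∀ n, (∫ w, g (e w) ∂μ) * ∫ w, Real.exp (-e' w) ∂μ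
      - ∫ w, d n w * Real.exp (-e' (T n w)) ∂μ = ∫ w, g (e w) * Real.exp (-e' (T n w)) ∂μ := by
    intro n
    rw [← (hT n).integral_add_inner_mul_exp hW (hgirsanov n) hgc hg1, ← integral_sub]
    · refine integral_congr_ae (.of_forall fun w => ?_)
      simp only [d, a]
      ring
    · exact ((hGT n).integrable (by norm_num)).bdd_mul (c := 1) (hs n) (.of_forall fun w => hg1 _)
    · exact ((hGT n).integrable (by norm_num)).bdd_mul (c := 2) (hdm n)
        (.of_forall fun w => hd2 n w)
  simpa [hdiff] using hsmall.const_sub ((∫ w, g (e w) ∂μ) * ∫ w, Real.exp (-e' w) ∂μ)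

/-- The functions `cos e` and `sin e` are total in `L²(μ)`, and so are the functions
`exp (-e)`; hence mixing has to be checked for such pairs only. -/
theorem stronglyMixing_of_trig_exp (hW : IsAbstractWienerSpace i μ) {T : ℕ → W → W}
    (hT : ∀ n, MeasurePreserving (T n) μ μ)
    (h : ∀ g : ℝ → ℝ, g = Real.cos ∨ g = Real.sin → ∀ e e' : StrongDual ℝ W,
      Tendsto (fun n => ∫ w, g (e w) * Real.exp (-e' (T n w)) ∂μ) atTop
        (𝓝 ((∫ w, g (e w) ∂μ) * ∫ w, Real.exp (-e' w) ∂μ))) :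
    StronglyMixing μ T := by
  have := hW.isProbabilityMeasure
  have h1L : MemLp (fun _ : W => (1 : ℝ)) 2 μ := memLp_const 1
  let one : Lp ℝ 2 μ := h1L.toLp _
  -- `A n G = G ∘ T n - E[G]`, so mixing says that `A n` tends to `0` in the weak operator topology.
  let A : ℕ → Lp ℝ 2 μ →L[ℝ] Lp ℝ 2 μ := fun n =>
    (Lp.compMeasurePreservingₗᵢ ℝ (T n) (hT n)).toContinuousLinearMap
      - (innerSL ℝ one).smulRight one
  have hA : ∀ {F G : W → ℝ} (hF : MemLp F 2 μ) (hG : MemLp G 2 μ) (n : ℕ),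
      inner ℝ (hF.toLp F) (A n (hG.toLp G))
        = ∫ w, F w * G (T n w) ∂μ - (∫ w, F w ∂μ) * ∫ w, G w ∂μ := by
    intro F G hF hG n
    have h2 : A n (hG.toLp G) = (hG.comp_measurePreserving (hT n)).toLp _
        - inner ℝ one (hG.toLp G) • one := rfl
    rw [h2, inner_sub_right, inner_toLp_toLp, real_inner_smul_right, inner_toLp_toLp,
      inner_toLp_toLp]
    simp [mul_comm]
  have hAb : ∃ C, ∀ n, ‖A n‖ ≤ C :=
    ⟨1 + ‖(innerSL ℝ one).smulRight one‖, fun n => (norm_sub_le _ _).trans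
      (by gcongr; exact LinearIsometry.norm_toContinuousLinearMap_le _)⟩
  obtain ⟨C, hC⟩ := hAb
  have htrig : ∀ g : ℝ → ℝ, g = Real.cos ∨ g = Real.sin → ∀ e : StrongDual ℝ W,
      MemLp (fun w => g (e w)) 2 μ := by
    rintro g (rfl | rfl) e
    · exact .of_bound (Continuous.aestronglyMeasurable (by fun_prop)) 1
        (.of_forall fun w => Real.abs_cos_le_one _)
    · exact .of_bound (Continuous.aestronglyMeasurable (by fun_prop)) 1
        (.of_forall fun w => Real.abs_sin_le_one _)
  have hexp : ∀ e : StrongDual ℝ W, MemLp (fun w => Real.exp (-e w)) 2 μ := fun e =>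
    hW.memLp_exp (-e)
  have step : ∀ (e' : StrongDual ℝ W) (F : Lp ℝ 2 μ),
      Tendsto (fun n => inner ℝ F (A n ((hexp e').toLp _))) atTop (𝓝 0) := by
    intro e'
    refine tendsto_inner_zero_of_total
      (S := {F | ∃ (g : ℝ → ℝ) (hg : g = Real.cos ∨ g = Real.sin) (e : StrongDual ℝ W),
        F = (htrig g hg e).toLp _}) (fun X hX => ?_)
      (C := C * ‖(hexp e').toLp _‖) (fun n => ContinuousLinearMap.le_of_opNorm_le _ (hC n) _) ?_
    · have hz : ∀ g : ℝ → ℝ, g = Real.cos ∨ g = Real.sin → ∀ e : StrongDual ℝ W,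
          ∫ w, X w * g (e w) ∂μ = 0 := by
        intro g hg e
        have := hX _ ⟨g, hg, e, rfl⟩
        rw [← Lp.toLp_coeFn X (Lp.memLp X), inner_toLp_toLp] at this
        simpa [mul_comm] using this
      rw [Lp.eq_zero_iff_ae_eq_zero]
      exact ae_eq_zero_of_integral_cos_sin_eq_zero ((Lp.memLp X).integrable (by norm_num))
        (hz _ (Or.inl rfl)) (hz _ (Or.inr rfl))
    · rintro _ ⟨g, hg, e, rfl⟩
      simp_rw [hA]
      exact tendsto_sub_nhds_zero_iff.2 (h g hg e e')
  have main : ∀ F G : Lp ℝ 2 μ, Tendsto (fun n => inner ℝ F (A n G)) atTop (𝓝 0) := by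
    intro F G
    -- Passing to the adjoint puts the fixed total family on the left, now in the variable `G`.
    have := tendsto_inner_zero_of_total
      (S := {G | ∃ e : StrongDual ℝ W, G = (hexp e).toLp _}) (fun X hX => ?_)
      (x := fun n => (A n).adjoint F) (C := C * ‖F‖)
      (fun n => ContinuousLinearMap.le_of_opNorm_le _
        (by rw [LinearIsometryEquiv.norm_map]; exact hC n) _) ?_ G
    · refine this.congr fun n => ?_
      rw [ContinuousLinearMap.adjoint_inner_right, real_inner_comm]
    · rw [Lp.eq_zero_iff_ae_eq_zero]
      refine ae_eq_zero_of_integral_exp_eq_zero (Lp.memLp X) hW.memLp_exp fun e => ?_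
      have := hX _ ⟨-e, rfl⟩
      rw [← Lp.toLp_coeFn X (Lp.memLp X), inner_toLp_toLp] at this
      simpa [mul_comm] using this
    · rintro _ ⟨e, rfl⟩
      refine (step e F).congr fun n => ?_
      rw [ContinuousLinearMap.adjoint_inner_right, real_inner_comm]
  intro F G hF hG
  have := main (hF.toLp F) (hG.toLp G)
  simp_rw [hA] at this
  exact tendsto_sub_nhds_zero_iff.1 this

end Mixing

end WienerSpace

theorem theorem4 {W H : Type*}
    [NormedAddCommGroup W] [NormedSpace ℝ W] [CompleteSpace W]
    [TopologicalSpace.SeparableSpace W] [MeasurableSpace W] [BorelSpace W]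
    [NormedAddCommGroup H] [InnerProductSpace ℝ H] [CompleteSpace H]
    (i : H →L[ℝ] W) (μ : Measure W) (hW : WienerSpace.IsAbstractWienerSpace i μ)
    (Q : ℕ → W → H →L[ℝ] H)
    (hQ : ∀ n, WienerSpace.IsRandomIsometry μ (Q n))
    (hdom : ∀ n (h : H), WienerSpace.MemDivergenceDomain i μ (fun w => Q n w h))
    (hgauss : ∀ n (h : H),
      HasLaw (WienerSpace.divergence i μ (fun w => Q n w h)) (gaussianReal 0 (‖h‖₊ ^ 2)) μ)
    (hgirsanov : ∀ n (h : H) (F : W →ᵇ ℝ),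
      ∫ w, F (w + i (Q n w h)) *
          Real.exp (-WienerSpace.divergence i μ (fun w' => Q n w' h) w - ‖h‖ ^ 2 / 2) ∂μ
        = ∫ w, F w ∂μ) :
    -- the measure preserving transformation defined by `Q n` exists and is almost surely unique
    (∀ n, ∃ T : W → W, WienerSpace.IsRotationOf i μ (Q n) T ∧
      ∀ T' : W → W, WienerSpace.IsRotationOf i μ (Q n) T' → T' =ᵐ[μ] T) ∧
    -- the sufficient condition for strong mixing
    (∀ T : ℕ → W → W, (∀ n, WienerSpace.IsRotationOf i μ (Q n) (T n)) →
      (∀ h k : H,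
        TendstoInMeasure μ (fun n w => inner ℝ (Q n w h) k) atTop (fun _ => (0 : ℝ))) →
      WienerSpace.StronglyMixing μ T) := by
  have := UniformSpace.secondCountable_of_separable W
  refine ⟨fun n => ?_, fun T hT hlim => ?_⟩
  · obtain ⟨T, hT⟩ := hW.exists_isRotationOf (hdom n) (hgauss n)
    exact ⟨T, hT, fun T' hT' => hT'.ae_unique hW hT⟩
  · refine WienerSpace.stronglyMixing_of_trig_exp hW (fun n => (hT n).measurePreserving) ?_
    rintro g (rfl | rfl) e e'
    · exact WienerSpace.tendsto_integral_mul_exp_comp hW hQ hT hgirsanov hlim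
        Real.lipschitzWith_cos Real.abs_cos_le_one e e'
    · exact WienerSpace.tendsto_integral_mul_exp_comp hW hQ hT hgirsanov hlim
        Real.lipschitzWith_sin Real.abs_sin_le_one e e'
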